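/- Let $d\ge 0$ be an integer, let $K$ be a compact subset of $\mathbb R^d$ (with the Euclidean metric), and let $s=\dim_{\mathcal H}(K)$ be its Hausdorff dimension. For $\alpha>0$ let $\mathcal H^\alpha$ denote the $\alpha$-dimensional Hausdorff measure. There exists a family $(E_\alpha)_{\alpha\in(0,s)}$ of compact subsets of $K$ such that - for every $\alpha\in(0,s)$, $0<\mathcal H^\alpha(E_\alpha)<+\infty$; - for all $0<\alpha\le\beta<s$, $E_\alpha\subset E_\beta$. -/

import Mathlib

open scoped MeasureTheory

/-! ### Finite families of words: weights and admissible selections. -/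

namespace CodeTree

variable {A : Type*}

/-! Binary digits code a cube around `K` by sequences with letters in `Fin d → Fin 2`. Up to
constants, Hausdorff measure becomes the cost of covers by cylinders, a word of length `n` weighing
`2 ^ (-α n)`. Fix `b₀ < b < s`. Since `K` has infinite `b`-measure, some word is `Big`, and below a
big word lie arbitrarily long big words whose covers by prefixes all cost at least a quarter of its
`b`-weight (`Big.exists_family`).

Nestedness rests on one inequality: raising the exponent shrinks the weight of a word relative to
its prefixes. A family obeying the upper bounds `Adm` at `α` therefore obeys them at every `β ≥ α`
(`Adm.mono`), and can be enlarged greedily as the exponent rises. A maximal family has almost full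
mass (`Adm.le_cost_of_maximal`): otherwise every candidate has a saturated prefix, and these
prefixes form a cover whose `b`-cost forces full mass. A finite grid of exponents suffices
(`exists_monotone_adm`).

Iterating the selection down the tree, with losses of bounded total effect, gives nested limit sets
(`exists_monotone_sets`). The bound on total mass makes their measure finite; the local bounds and
the surviving mass make it positive, as in the mass distribution principle. Letting `b₀` increase to
`s`, the resulting families are glued by finite unions. -/

/-- The weight `2 ^ (-α |w|)` of a word. -/
noncomputable def wt (α : ℝ) (w : List A) : ℝ := (2 : ℝ) ^ (-(α * w.length))

/-- The total weight of a finite set of words. -/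
noncomputable def cost (α : ℝ) (F : Finset (List A)) : ℝ := ∑ w ∈ F, wt α w

lemma wt_pos (α : ℝ) (w : List A) : 0 < wt α w := Real.rpow_pos_of_pos two_pos _

lemma wt_zero (w : List A) : wt 0 w = 1 := by simp [wt]

lemma wt_le_one {α : ℝ} (hα : 0 ≤ α) (w : List A) : wt α w ≤ 1 :=
  Real.rpow_le_one_of_one_le_of_nonpos one_le_two (by simp only [neg_nonpos]; positivity)

lemma wt_anti {α : ℝ} (hα : 0 ≤ α) {v w : List A} (h : v.length ≤ w.length) :
    wt α w ≤ wt α v := by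
  unfold wt
  apply Real.rpow_le_rpow_of_exponent_le one_le_two
  have : (v.length : ℝ) ≤ w.length := by exact_mod_cast h
  nlinarith

/-- The relative weight of `w` in `v` is `2 ^ (-α (|w| - |v|))`, which decreases in the exponent. -/
lemma wt_mul_le {α β : ℝ} (h : α ≤ β) {v w : List A} (hl : v.length ≤ w.length) :
    wt β w * wt α v ≤ wt α w * wt β v := by
  unfold wt
  rw [← Real.rpow_add two_pos, ← Real.rpow_add two_pos]
  apply Real.rpow_le_rpow_of_exponent_le one_le_two
  have : (v.length : ℝ) ≤ w.length := by exact_mod_cast hl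
  nlinarith

lemma four_mul_wt_mul_le {α β : ℝ} {m : ℕ} (h : α ≤ β) (hm : 2 ≤ (β - α) * m) {v w : List A}
    (hl : v.length + m ≤ w.length) : 4 * (wt β w * wt α v) ≤ wt α w * wt β v := by
  unfold wt
  have h4 : (4 : ℝ) = 2 ^ (2 : ℝ) := by norm_num
  rw [h4, ← Real.rpow_add two_pos, ← Real.rpow_add two_pos, ← Real.rpow_add two_pos]
  apply Real.rpow_le_rpow_of_exponent_le one_le_two
  have : (v.length : ℝ) + m ≤ w.length := by exact_mod_cast hl
  nlinarith

lemma wt_le_of_length {α : ℝ} (hα : 0 ≤ α) {m : ℕ} {v w : List A}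
    (hl : v.length + m ≤ w.length) : wt α w ≤ (2 : ℝ) ^ (-(α * m)) * wt α v := by
  unfold wt
  rw [← Real.rpow_add two_pos]
  apply Real.rpow_le_rpow_of_exponent_le one_le_two
  have : (v.length : ℝ) + m ≤ w.length := by exact_mod_cast hl
  nlinarith

/-- Changing the exponent by at most `h` changes relative weights by at most `2 ^ (-h L)`. -/
lemma wt_shift {α β h L : ℝ} (hαβ : α ≤ β) (hβ : β ≤ α + h) {v w : List A}
    (hL : (w.length : ℝ) ≤ L) :
    (2 : ℝ) ^ (-(h * L)) * wt α w * wt β v ≤ wt β w * wt α v := by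
  unfold wt
  rw [← Real.rpow_add two_pos, ← Real.rpow_add two_pos, ← Real.rpow_add two_pos]
  apply Real.rpow_le_rpow_of_exponent_le one_le_two
  have h0 : (0 : ℝ) ≤ v.length := by positivity
  have h1 : (0 : ℝ) ≤ w.length := by positivity
  nlinarith [mul_le_mul_of_nonneg_right hαβ h0, mul_le_mul_of_nonneg_right hβ h1,
    mul_le_mul_of_nonneg_left hL (show 0 ≤ h by linarith)]

lemma cost_nonneg (α : ℝ) (F : Finset (List A)) : 0 ≤ cost α F :=
  Finset.sum_nonneg fun w _ => (wt_pos α w).le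

lemma cost_mono (α : ℝ) {F G : Finset (List A)} (h : F ⊆ G) : cost α F ≤ cost α G :=
  Finset.sum_le_sum_of_subset_of_nonneg h fun w _ _ => (wt_pos α w).le

lemma wt_le_cost (α : ℝ) {F : Finset (List A)} {w : List A} (h : w ∈ F) : wt α w ≤ cost α F :=
  Finset.single_le_sum (f := wt α) (fun w _ => (wt_pos α w).le) h

lemma prefix_or_prefix {u v w : List A} (hu : u <+: w) (hv : v <+: w) : u <+: v ∨ v <+: u :=
  (le_total u.length v.length).imp (List.prefix_of_prefix_length_le hu hv)
    (List.prefix_of_prefix_length_le hv hu)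

lemma cost_mul_le {α β : ℝ} (h : α ≤ β) {Q : List A} {T : Finset (List A)}
    (hT : ∀ J ∈ T, Q <+: J) : cost β T * wt α Q ≤ cost α T * wt β Q := by
  unfold cost
  rw [Finset.sum_mul, Finset.sum_mul]
  exact Finset.sum_le_sum fun J hJ => wt_mul_le h (hT J hJ).length_le

variable [DecidableEq A]

lemma cost_union_le (α : ℝ) (F G : Finset (List A)) :
    cost α (F ∪ G) ≤ cost α F + cost α G := by
  unfold cost
  rw [← Finset.sum_union_inter]
  exact le_add_of_nonneg_right (Finset.sum_nonneg fun w _ => (wt_pos α w).le)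

lemma cost_biUnion_le {ι : Type*} (α : ℝ) (s : Finset ι) (f : ι → Finset (List A)) :
    cost α (s.biUnion f) ≤ ∑ i ∈ s, cost α (f i) := by
  classical
  induction s using Finset.induction_on with
  | empty => simp [cost]
  | insert i s hi ih =>
    rw [Finset.biUnion_insert, Finset.sum_insert hi]
    exact (cost_union_le _ _ _).trans (by linarith)

/-- The words of `F` that extend `Q`. -/
def below (F : Finset (List A)) (Q : List A) : Finset (List A) := F.filter (Q <+: ·)

@[simp] lemma mem_below {F : Finset (List A)} {Q w : List A} :
    w ∈ below F Q ↔ w ∈ F ∧ Q <+: w := Finset.mem_filter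

/-- No word of `F` extends another one. -/
def Incomparable (F : Finset (List A)) : Prop := ∀ v ∈ F, ∀ w ∈ F, v <+: w → v = w

/-- Keep the words of `P` that have no proper prefix in `P`. -/
lemma exists_incomparable_subset (P : Finset (List A)) :
    ∃ F ⊆ P, Incomparable F ∧ ∀ J ∈ P, ∃ Q ∈ F, Q <+: J := by
  refine ⟨P.filter fun w => ∀ Q ∈ P, Q <+: w → Q = w, Finset.filter_subset _ _, ?_, ?_⟩
  · intro v hv w hw hvw
    exact (Finset.mem_filter.1 hw).2 v (Finset.mem_filter.1 hv).1 hvw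
  · intro J hJ
    obtain ⟨Q, hQ, hmin⟩ := (P.filter (· <+: J)).exists_min_image List.length
      ⟨J, by simp [hJ]⟩
    rw [Finset.mem_filter] at hQ
    refine ⟨Q, Finset.mem_filter.2 ⟨hQ.1, fun R hR hRQ => ?_⟩, hQ.2⟩
    exact hRQ.eq_of_length_le (hmin R (Finset.mem_filter.2 ⟨hR, hRQ.trans hQ.2⟩))

lemma sum_cost_below_le (α : ℝ) {F : Finset (List A)} (hF : Incomparable F)
    (T : Finset (List A)) : ∑ Q ∈ F, cost α (below T Q) ≤ cost α T := by
  unfold cost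
  rw [← Finset.sum_biUnion]
  · refine cost_mono α fun w hw => ?_
    obtain ⟨Q, -, hQ⟩ := Finset.mem_biUnion.1 hw
    exact (mem_below.1 hQ).1
  · intro Q hQ R hR hne
    refine Finset.disjoint_left.2 fun w hw hw' => hne ?_
    rcases prefix_or_prefix (mem_below.1 hw).2 (mem_below.1 hw').2 with h | h
    · exact hF _ hQ _ hR h
    · exact (hF _ hR _ hQ h).symm

/-- `T` carries at most the mass of `I`, and at most five times the mass of each word below `I`. -/
structure Adm (α : ℝ) (I : List A) (T : Finset (List A)) : Prop where
  total : cost α T ≤ wt α I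
  local_le : ∀ Q, I <+: Q → cost α (below T Q) ≤ 5 * wt α Q

/-- This is the source of nestedness: both bounds compare words with a common prefix, so they relax
as the exponent grows. -/
lemma Adm.mono {α β : ℝ} (h : α ≤ β) {I : List A} {T : Finset (List A)}
    (hT : ∀ J ∈ T, I <+: J) (hA : Adm α I T) : Adm β I T := by
  constructor
  · have h1 := cost_mul_le h hT
    have h2 := mul_le_mul_of_nonneg_right hA.total (wt_pos β I).le
    refine le_of_mul_le_mul_right ?_ (wt_pos α I)
    linarith
  · intro Q hQ
    have h1 := cost_mul_le (T := below T Q) h fun J hJ => (mem_below.1 hJ).2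
    have h2 := mul_le_mul_of_nonneg_right (hA.local_le Q hQ) (wt_pos β Q).le
    refine le_of_mul_le_mul_right ?_ (wt_pos α Q)
    linarith

lemma Adm.exists_maximal {α : ℝ} {I : List A} {P T₀ : Finset (List A)} (h₀ : T₀ ⊆ P)
    (hA : Adm α I T₀) : ∃ T, T₀ ⊆ T ∧ T ⊆ P ∧ Adm α I T ∧
      ∀ J ∈ P, J ∉ T → ¬ Adm α I (insert J T) := by
  classical
  obtain ⟨T, hT, hmax⟩ := (P.powerset.filter fun T => T₀ ⊆ T ∧ Adm α I T).exists_max_image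
    Finset.card ⟨T₀, by simp [h₀, hA]⟩
  simp only [Finset.mem_filter, Finset.mem_powerset] at hT hmax
  refine ⟨T, hT.2.1, hT.1, hT.2.2, fun J hJ hJT hA' => ?_⟩
  have := hmax (insert J T) ⟨Finset.insert_subset hJ hT.1,
    hT.2.1.trans (Finset.subset_insert _ _), hA'⟩
  rw [Finset.card_insert_of_notMem hJT] at this
  omega

/-- A maximal admissible family has almost full mass. -/
lemma Adm.le_cost_of_maximal {α b : ℝ} {m : ℕ} {I : List A} {P T : Finset (List A)}
    (hα : 0 ≤ α) (hαb : α ≤ b) (hm : 2 ≤ (b - α) * m)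
    (hlen : ∀ J ∈ P, I.length + m ≤ J.length)
    (hP : ∀ F : Finset (List A), (∀ J ∈ P, ∃ Q ∈ F, Q <+: J) → wt b I / 4 ≤ cost b F)
    (hA : Adm α I T) (hmax : ∀ J ∈ P, J ∉ T → ¬ Adm α I (insert J T)) :
    (1 - (2 : ℝ) ^ (-(α * m))) * wt α I ≤ cost α T := by
  by_contra! hlt
  -- Every candidate has a saturated prefix: itself if it was selected (the length gap `m` gives the
  -- factor 4), otherwise a prefix whose local bound blocks its insertion.
  have key : ∀ J ∈ P, ∃ Q, Q <+: J ∧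
      4 * (wt b Q * wt α I) ≤ cost α (below T Q) * wt b I := by
    intro J hJ
    by_cases hJT : J ∈ T
    · refine ⟨J, List.prefix_rfl, (four_mul_wt_mul_le hαb hm (hlen J hJ)).trans ?_⟩
      exact mul_le_mul_of_nonneg_right (wt_le_cost α (by simp [hJT])) (wt_pos b I).le
    · have hnot := hmax J hJ hJT
      -- The missing mass exceeds the weight of `J`, so the total bound cannot be what fails.
      have htot : cost α (insert J T) ≤ wt α I := by
        have := wt_le_of_length hα (hlen J hJ)
        rw [cost, Finset.sum_insert hJT, ← cost]
        linarith
      obtain ⟨Q, hIQ, hQ⟩ : ∃ Q, I <+: Q ∧ 5 * wt α Q < cost α (below (insert J T) Q) := by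
        by_contra! hcon
        exact hnot ⟨htot, hcon⟩
      have hQJ : Q <+: J := by
        by_contra hQJ
        rw [below, Finset.filter_insert, if_neg hQJ] at hQ
        exact absurd (hA.local_le Q hIQ) (not_le.2 hQ)
      refine ⟨Q, hQJ, ?_⟩
      rw [below, Finset.filter_insert, if_pos hQJ, cost, Finset.sum_insert (by simp [hJT]),
        ← cost, ← below] at hQ
      -- The inserted word weighs at most `wt α Q`, which turns the violated constant 5 into 4.
      have h1 := wt_anti hα hQJ.length_le
      have h2 := wt_mul_le hαb hIQ.length_le
      have h3 : 4 * wt α Q * wt b I ≤ cost α (below T Q) * wt b I :=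
        mul_le_mul_of_nonneg_right (by linarith) (wt_pos b I).le
      linarith
  choose! q hqJ hq using key
  -- Incomparable saturated prefixes carry disjoint parts of `T`, so their masses add up, while they
  -- still cover `P`.
  obtain ⟨F, hFsub, hF, hcov⟩ := exists_incomparable_subset (P.image q)
  have h1 : wt b I / 4 ≤ cost b F := hP F fun J hJ => by
    obtain ⟨Q, hQF, hQ⟩ := hcov (q J) (Finset.mem_image_of_mem q hJ)
    exact ⟨Q, hQF, hQ.trans (hqJ J hJ)⟩
  have h2 : 4 * (cost b F * wt α I) ≤ cost α T * wt b I := by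
    calc 4 * (cost b F * wt α I) = ∑ Q ∈ F, 4 * (wt b Q * wt α I) := by
          rw [cost, Finset.sum_mul, Finset.mul_sum]
      _ ≤ ∑ Q ∈ F, cost α (below T Q) * wt b I := by
          refine Finset.sum_le_sum fun Q hQ => ?_
          obtain ⟨J, hJ, rfl⟩ := Finset.mem_image.1 (hFsub hQ)
          exact hq J hJ
      _ ≤ cost α T * wt b I := by
          rw [← Finset.sum_mul]
          exact mul_le_mul_of_nonneg_right (sum_cost_below_le α hF T) (wt_pos b I).le
  have h3 := mul_le_mul_of_nonneg_right h1 (wt_pos α I).le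
  have h4 : wt α I ≤ cost α T := le_of_mul_le_mul_right (by linarith) (wt_pos b I)
  have h5 : 0 < (2 : ℝ) ^ (-(α * m)) := Real.rpow_pos_of_pos two_pos _
  nlinarith [wt_pos α I]

/-- Admissible subfamilies of `P` that grow with the exponent, and have almost full mass. -/
lemma exists_monotone_adm {a b₀ b θ : ℝ} {m : ℕ} {I : List A} {P : Finset (List A)}
    (ha : 0 < a) (hb : b₀ ≤ b) (hm : 2 ≤ (b - b₀) * m) (hθ0 : 0 ≤ θ) (hθ : θ < 1)
    (hma : (2 : ℝ) ^ (-(a / 2 * m)) ≤ 1 - (1 + θ) / 2)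
    (hI : ∀ J ∈ P, I <+: J) (hlen : ∀ J ∈ P, I.length + m ≤ J.length)
    (hP : ∀ F : Finset (List A), (∀ J ∈ P, ∃ Q ∈ F, Q <+: J) → wt b I / 4 ≤ cost b F) :
    ∃ T : ℝ → Finset (List A), Monotone T ∧ (∀ α, T α ⊆ P ∧ (T α).Nonempty) ∧
      (∀ α, 0 ≤ α → Adm α I (T α)) ∧
      ∀ α, a ≤ α → α ≤ b₀ → θ * wt α I ≤ cost α (T α) := by
  have hPne : P.Nonempty := by
    by_contra hne
    rw [Finset.not_nonempty_iff_eq_empty] at hne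
    have := hP ∅ (by simp [hne])
    have := wt_pos b I
    simp [cost] at *
    linarith
  obtain ⟨J₀, hJ₀⟩ := hPne
  -- Mass is lost twice, by maximality and by rounding the exponent to the grid; each loss keeps a
  -- factor `ρ`, and `ρ ^ 2 ≥ θ`.
  set ρ := (1 + θ) / 2 with hρ
  obtain ⟨L, hL0, hL⟩ : ∃ L : ℝ, 0 < L ∧ ∀ J ∈ P, (J.length : ℝ) ≤ L := by
    refine ⟨(∑ J ∈ P, J.length : ℕ) + 1, by positivity, fun J hJ => ?_⟩
    have := Finset.single_le_sum (f := List.length) (fun _ _ => Nat.zero_le _) hJ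
    have h : (J.length : ℝ) ≤ (∑ J ∈ P, J.length : ℕ) := by exact_mod_cast this
    linarith
  -- The mesh `h` is so small that rounding costs at most the factor `ρ`, and that the grid point
  -- below any `α ≥ a` is still at least `a / 2`.
  obtain ⟨h, hh0, hha, hhL⟩ : ∃ h : ℝ, 0 < h ∧ h ≤ a / 2 ∧ ρ ≤ (2 : ℝ) ^ (-(h * L)) := by
    have hcont : Filter.Tendsto (fun h : ℝ => (2 : ℝ) ^ (-(h * L))) (nhds 0) (nhds 1) := by
      have : Continuous fun h : ℝ => (2 : ℝ) ^ (-(h * L)) := by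
        have : Continuous fun h : ℝ => -(h * L) := by fun_prop
        exact continuous_const.rpow this fun _ => Or.inl two_ne_zero
      simpa using this.tendsto 0
    have h1 : ∀ᶠ h in nhds (0 : ℝ), ρ < (2 : ℝ) ^ (-(h * L)) :=
      hcont.eventually_const_lt (by linarith)
    obtain ⟨δ, hδ, hδ'⟩ := Metric.eventually_nhds_iff.1 h1
    refine ⟨min (δ / 2) (a / 2), by positivity, min_le_right _ _, (hδ' ?_).le⟩
    rw [Real.dist_eq, sub_zero, abs_of_pos (by positivity)]
    exact (min_le_left _ _).trans_lt (by linarith)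
  have hstep : ∀ (i : ℕ) (T₀ : Finset (List A)), ∃ T : Finset (List A),
      T₀ ⊆ P → Adm (i * h) I T₀ → T₀ ⊆ T ∧ T ⊆ P ∧ Adm (i * h) I T ∧
      ∀ J ∈ P, J ∉ T → ¬ Adm (i * h) I (insert J T) := by
    intro i T₀
    by_cases h₀ : T₀ ⊆ P ∧ Adm (i * h) I T₀
    · obtain ⟨T, hT⟩ := h₀.2.exists_maximal h₀.1
      exact ⟨T, fun _ _ => hT⟩
    · exact ⟨∅, fun h1 h2 => (h₀ ⟨h1, h2⟩).elim⟩
  choose next hnext using hstep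
  -- The singleton start is admissible at exponent 0, where all weights are 1; it makes all later
  -- families nonempty.
  let U : ℕ → Finset (List A) := fun i => Nat.rec {J₀} (fun i T => next i T) i
  have hU : ∀ i, U i ⊆ P ∧ Adm (i * h) I (U i) := by
    intro i
    induction i with
    | zero =>
      refine ⟨by simpa [U] using hJ₀, ?_, fun Q _ => ?_⟩
      · simp [U, cost, wt_zero]
      · simp only [Nat.cast_zero, zero_mul, wt_zero]
        refine (cost_mono 0 (Finset.filter_subset _ _)).trans ?_
        simp [U, cost, wt_zero]
    | succ i ih =>
      obtain ⟨-, h2, h3, -⟩ := hnext i (U i) ih.1 ih.2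
      refine ⟨h2, h3.mono ?_ fun J hJ => hI J (h2 hJ)⟩
      push_cast
      nlinarith
  have hUnext : ∀ i, U i ⊆ U (i + 1) ∧ Adm (i * h) I (U (i + 1)) ∧
      ∀ J ∈ P, J ∉ U (i + 1) → ¬ Adm (i * h) I (insert J (U (i + 1))) := fun i => by
    obtain ⟨h1, -, h3, h4⟩ := hnext i (U i) (hU i).1 (hU i).2
    exact ⟨h1, h3, h4⟩
  have hUmono : Monotone U := monotone_nat_of_le_succ fun i => (hUnext i).1
  -- The shift by one matters: `U (i + 1)` is the family that is maximal at exponent `i * h`.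
  refine ⟨fun α => U (⌊α / h⌋₊ + 1), ?_, ?_, ?_, ?_⟩
  · intro α β hαβ
    exact hUmono (Nat.add_le_add_right (Nat.floor_mono (by gcongr)) 1)
  · exact fun α => ⟨(hU (⌊α / h⌋₊ + 1)).1, J₀,
      hUmono (Nat.zero_le (⌊α / h⌋₊ + 1)) (Finset.mem_singleton_self J₀)⟩
  · intro α hα
    refine (hUnext ⌊α / h⌋₊).2.1.mono ?_ fun J hJ => hI J ((hU (⌊α / h⌋₊ + 1)).1 hJ)
    exact (le_div_iff₀ hh0).1 (Nat.floor_le (by positivity))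
  · intro α haα hαb
    set i := ⌊α / h⌋₊
    have hi : i * h ≤ α := (le_div_iff₀ hh0).1 (Nat.floor_le (div_nonneg (by linarith) hh0.le))
    have hi' : α ≤ i * h + h := by
      have := (Nat.lt_floor_add_one (α / h)).le
      rw [div_le_iff₀ hh0] at this
      linarith
    have hc := Adm.le_cost_of_maximal (b := b) (by positivity) (by linarith)
      (hm.trans (by gcongr; linarith)) hlen hP (hUnext i).2.1 (hUnext i).2.2
    have hρ' : ρ ≤ 1 - (2 : ℝ) ^ (-(i * h * m)) := by
      have : (2 : ℝ) ^ (-(i * h * m)) ≤ (2 : ℝ) ^ (-(a / 2 * m)) := by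
        apply Real.rpow_le_rpow_of_exponent_le one_le_two
        have : a / 2 ≤ i * h := by linarith
        have := mul_le_mul_of_nonneg_right this (Nat.cast_nonneg (α := ℝ) m)
        linarith
      linarith
    have hs : (2 : ℝ) ^ (-(h * L)) * cost (i * h) (U (i + 1)) * wt α I ≤
        cost α (U (i + 1)) * wt (i * h) I := by
      unfold cost
      rw [Finset.mul_sum, Finset.sum_mul, Finset.sum_mul]
      exact Finset.sum_le_sum fun J hJ => wt_shift hi hi' (hL J ((hU (i + 1)).1 hJ))
    have hρ0 : 0 ≤ ρ := by linarith
    have h1 : ρ * wt (i * h) I ≤ cost (i * h) (U (i + 1)) :=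
      (mul_le_mul_of_nonneg_right hρ' (wt_pos _ I).le).trans hc
    have h2 : ρ * (ρ * wt (i * h) I) * wt α I ≤ cost α (U (i + 1)) * wt (i * h) I := by
      refine le_trans ?_ hs
      refine mul_le_mul_of_nonneg_right ?_ (wt_pos _ I).le
      exact mul_le_mul hhL h1 (mul_nonneg hρ0 (wt_pos _ I).le) (hρ0.trans hhL)
    have h3 : ρ * ρ * wt α I ≤ cost α (U (i + 1)) :=
      le_of_mul_le_mul_right (by linarith) (wt_pos (i * h) I)
    have h4 : θ ≤ ρ * ρ := by nlinarith [sq_nonneg (1 - θ)]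
    exact (mul_le_mul_of_nonneg_right h4 (wt_pos α I).le).trans h3

end CodeTree

/-! ### Sequence space: cylinders, big words and the nested tree construction. -/

namespace CodeTree

variable {A : Type*}

/-- The first `n` letters of a sequence. -/
def pre (x : ℕ → A) (n : ℕ) : List A := List.ofFn fun i : Fin n => x i

@[simp] lemma length_pre (x : ℕ → A) (n : ℕ) : (pre x n).length = n := List.length_ofFn

lemma pre_prefix (x : ℕ → A) {m n : ℕ} (h : m ≤ n) : pre x m <+: pre x n := by
  rw [List.prefix_iff_eq_take, length_pre]
  apply List.ext_getElem <;> simp [pre, h]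

lemma pre_eq_pre_iff {x y : ℕ → A} {n : ℕ} : pre x n = pre y n ↔ ∀ i < n, x i = y i := by
  rw [pre, pre, List.ofFn_inj]
  exact ⟨fun h i hi => congrFun h ⟨i, hi⟩, fun h => funext fun i => h i i.2⟩

/-- The cylinder of sequences that start with the word `w`. -/
def cyl (w : List A) : Set (ℕ → A) := {x | pre x w.length = w}

lemma mem_cyl_pre (x : ℕ → A) (n : ℕ) : x ∈ cyl (pre x n) := by
  simp [cyl]

lemma prefix_of_mem_cyl {x : ℕ → A} {v w : List A} (hv : x ∈ cyl v) (hw : x ∈ cyl w)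
    (h : v.length ≤ w.length) : v <+: w := by
  rw [← show pre x v.length = v from hv, ← show pre x w.length = w from hw]
  exact pre_prefix x h

lemma cyl_anti {v w : List A} (h : v <+: w) : cyl w ⊆ cyl v := by
  intro x hx
  have h1 : pre x v.length <+: w := by
    have := pre_prefix x h.length_le
    rwa [show pre x w.length = w from hx] at this
  exact (List.prefix_of_prefix_length_le h1 h (by simp)).eq_of_length (by simp)

lemma isClopen_cyl [TopologicalSpace A] [DiscreteTopology A] (w : List A) :
    IsClopen (cyl w) := by
  have : cyl w = (fun (x : ℕ → A) (i : Fin w.length) => x i) ⁻¹' {v | List.ofFn v = w} := rfl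
  rw [this]
  exact (isClopen_discrete _).preimage (by fun_prop)

/-- The cylinders of the words in `F` cover `S`. -/
def Covers (F : Finset (List A)) (S : Set (ℕ → A)) : Prop := ∀ x ∈ S, ∃ w ∈ F, x ∈ cyl w

lemma isClopen_cover [TopologicalSpace A] [DiscreteTopology A] (F : Finset (List A)) :
    IsClopen {x : ℕ → A | ∃ w ∈ F, x ∈ cyl w} := by
  have : {x : ℕ → A | ∃ w ∈ F, x ∈ cyl w} = ⋃ w ∈ F, cyl w := by ext; simp
  rw [this]
  exact isClopen_biUnion_finset fun w _ => isClopen_cyl w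

lemma exists_cover_of_length [Finite A] (S : Set (ℕ → A)) (n : ℕ) :
    ∃ F : Finset (List A), Covers F S ∧ ∀ w ∈ F, w.length = n := by
  classical
  have := Fintype.ofFinite A
  refine ⟨Finset.univ.image (List.ofFn : (Fin n → A) → List A), fun x _ => ?_, fun w hw => ?_⟩
  · exact ⟨pre x n, Finset.mem_image_of_mem _ (Finset.mem_univ _), mem_cyl_pre x n⟩
  · obtain ⟨v, -, rfl⟩ := Finset.mem_image.1 hw
    simp

/-- Covering the part of `K` in the cylinder of `w` costs at least half the weight of `w`. -/
def Big (b : ℝ) (K : Set (ℕ → A)) (w : List A) : Prop :=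
  ∀ F : Finset (List A), Covers F (K ∩ cyl w) → wt b w / 2 ≤ cost b F

lemma Big.nonempty {b : ℝ} {K : Set (ℕ → A)} {w : List A} (h : Big b K w) :
    (K ∩ cyl w).Nonempty := by
  by_contra hne
  rw [Set.not_nonempty_iff_eq_empty] at hne
  have := h ∅ (by simp [hne, Covers])
  have := wt_pos b w
  simp only [cost, Finset.sum_empty] at *
  linarith

variable [DecidableEq A]

/-- A word of `F₀` meeting `N` is not big, so a cover of its part costing less than half its weight
can replace it; the other words are dropped. Iteration makes the cost arbitrarily small. -/
lemma exists_half_cover {b : ℝ} (hb : 0 ≤ b) {K N : Set (ℕ → A)} (hNK : N ⊆ K) {m : ℕ}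
    (hN : ∀ w : List A, m ≤ w.length → (N ∩ cyl w).Nonempty → ¬ Big b K w)
    {F₀ : Finset (List A)} (hF₀ : Covers F₀ N) (hm : ∀ w ∈ F₀, m ≤ w.length) :
    ∃ F, Covers F N ∧ (∀ w ∈ F, m ≤ w.length) ∧ cost b F ≤ cost b F₀ / 2 := by
  have key : ∀ w ∈ F₀, ∃ G, Covers G (N ∩ cyl w) ∧ (∀ v ∈ G, w <+: v) ∧
      cost b G ≤ wt b w / 2 := by
    intro w hw
    by_cases hne : (N ∩ cyl w).Nonempty
    · have := hN w (hm w hw) hne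
      rw [Big] at this
      push Not at this
      obtain ⟨G, hG, hlt⟩ := this
      -- Only extensions of `w` are needed: a word no longer than `w` would alone cost more than the
      -- whole of `G`.
      refine ⟨below G w, fun x hx => ?_, fun v hv => (mem_below.1 hv).2,
        (cost_mono b (Finset.filter_subset _ _)).trans hlt.le⟩
      obtain ⟨v, hv, hxv⟩ := hG x ⟨hNK hx.1, hx.2⟩
      rcases le_total w.length v.length with h | h
      · exact ⟨v, mem_below.2 ⟨hv, prefix_of_mem_cyl hx.2 hxv h⟩, hxv⟩
      · have h1 := wt_anti hb h
        have h2 := wt_le_cost b hv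
        have h3 := wt_pos b w
        linarith
    · rw [Set.not_nonempty_iff_eq_empty] at hne
      exact ⟨∅, by simp [hne, Covers], by simp, Finset.sum_empty.trans_le (half_pos (wt_pos b w)).le⟩
  choose! G hG hGw hGc using key
  refine ⟨F₀.biUnion G, fun x hx => ?_, fun v hv => ?_, ?_⟩
  · obtain ⟨w, hw, hxw⟩ := hF₀ x hx
    obtain ⟨v, hv, hxv⟩ := hG w hw x ⟨hx, hxw⟩
    exact ⟨v, Finset.mem_biUnion.2 ⟨w, hw, hv⟩, hxv⟩
  · obtain ⟨w, hw, hvw⟩ := Finset.mem_biUnion.1 hv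
    exact (hm w hw).trans (hGw w hw v hvw).length_le
  · refine (cost_biUnion_le b F₀ G).trans ?_
    rw [cost, Finset.sum_div]
    exact Finset.sum_le_sum hGc

lemma exists_small_cover [Finite A] {b : ℝ} (hb : 0 ≤ b) {K N : Set (ℕ → A)} (hNK : N ⊆ K)
    {m : ℕ} (hN : ∀ w : List A, m ≤ w.length → (N ∩ cyl w).Nonempty → ¬ Big b K w)
    {η : ℝ} (hη : 0 < η) :
    ∃ F, Covers F N ∧ (∀ w ∈ F, m ≤ w.length) ∧ cost b F ≤ η := by
  obtain ⟨F₀, hF₀, hm⟩ := exists_cover_of_length N m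
  have h : ∀ k : ℕ, ∃ F, Covers F N ∧ (∀ w ∈ F, m ≤ w.length) ∧
      cost b F ≤ cost b F₀ * (1 / 2) ^ k := by
    intro k
    induction k with
    | zero => exact ⟨F₀, hF₀, fun w hw => (hm w hw).ge, by simp⟩
    | succ k ih =>
      obtain ⟨F, h1, h2, h3⟩ := ih
      obtain ⟨F', h1', h2', h3'⟩ := exists_half_cover hb hNK hN h1 h2
      refine ⟨F', h1', h2', h3'.trans ?_⟩
      rw [pow_succ]
      linarith
  have hlim : Filter.Tendsto (fun k : ℕ => cost b F₀ * (1 / 2 : ℝ) ^ k) Filter.atTop (nhds 0) := by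
    simpa using (tendsto_pow_atTop_nhds_zero_of_lt_one (r := (1 / 2 : ℝ)) (by norm_num)
      (by norm_num)).const_mul (cost b F₀)
  obtain ⟨k, hk⟩ := (hlim.eventually_lt_const hη).exists
  obtain ⟨F, h1, h2, h3⟩ := h k
  exact ⟨F, h1, h2, h3.trans hk.le⟩

variable [TopologicalSpace A] [DiscreteTopology A] [Finite A]

/-- Long big words below a big word that carry at least a quarter of its weight. -/
lemma Big.exists_family {b : ℝ} (hb : 0 ≤ b) {K : Set (ℕ → A)} (hK : IsClosed K) {I : List A}
    (hI : Big b K I) (m : ℕ) : ∃ P : Finset (List A), Incomparable P ∧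
      (∀ J ∈ P, I <+: J ∧ I.length + m ≤ J.length ∧ Big b K J) ∧
      ∀ F : Finset (List A), (∀ J ∈ P, ∃ Q ∈ F, Q <+: J) → wt b I / 4 ≤ cost b F := by
  -- The points of `N` lie in no long big cylinder, so `N` has a cover of cost at most a quarter of
  -- `wt b I`. Removing it leaves a compact set covered by finitely many long big cylinders.
  let N : Set (ℕ → A) := {x ∈ K ∩ cyl I | ∀ w, I.length + m ≤ w.length → x ∈ cyl w → ¬ Big b K w}
  obtain ⟨F₀, hF₀, -, hcost⟩ := exists_small_cover (m := I.length + m) (N := N) hb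
    (fun x hx => hx.1.1) (fun w hw ⟨x, hx, hxw⟩ => hx.2 w hw hxw)
    (show 0 < wt b I / 4 by have := wt_pos b I; positivity)
  let C := (K ∩ cyl I) \ {x | ∃ w ∈ F₀, x ∈ cyl w}
  have hC : IsCompact C :=
    ((hK.inter (isClopen_cyl I).isClosed).sdiff (isClopen_cover F₀).isOpen).isCompact
  obtain ⟨t, ht⟩ := hC.elim_finite_subcover
    (fun w : {w : List A // I.length + m ≤ w.length ∧ Big b K w} => cyl w.1 ∩ cyl I)
    (fun w => (isClopen_cyl w.1).isOpen.inter (isClopen_cyl I).isOpen) (by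
      intro x hx
      have hxN : x ∉ N := fun h => hx.2 (hF₀ x h)
      simp only [N, Set.mem_ofPred_eq, not_and] at hxN
      have := hxN hx.1
      push Not at this
      obtain ⟨w, hw, hxw, hwB⟩ := this
      exact Set.mem_iUnion.2 ⟨⟨w, hw, hwB⟩, hxw, hx.1.2⟩)
  obtain ⟨P, hPsub, hP, hPcov⟩ :=
    exists_incomparable_subset ((t.image Subtype.val).filter (I <+: ·))
  refine ⟨P, hP, fun J hJ => ?_, fun F hF => ?_⟩
  · have := hPsub hJ
    rw [Finset.mem_filter, Finset.mem_image] at this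
    obtain ⟨⟨w, -, rfl⟩, h⟩ := this
    exact ⟨h, w.2⟩
  · have hcov : Covers (F ∪ F₀) (K ∩ cyl I) := by
      intro x hx
      by_cases hx0 : ∃ w ∈ F₀, x ∈ cyl w
      · obtain ⟨w, hw, hxw⟩ := hx0
        exact ⟨w, Finset.mem_union_right _ hw, hxw⟩
      · obtain ⟨w, hw, hxw⟩ := Set.mem_iUnion₂.1 (ht ⟨hx, hx0⟩)
        have hIw : I <+: w.1 :=
          prefix_of_mem_cyl hx.2 hxw.1 ((Nat.le_add_right _ _).trans w.2.1)
        obtain ⟨J, hJ, hJw⟩ := hPcov w.1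
          (Finset.mem_filter.2 ⟨Finset.mem_image_of_mem _ hw, hIw⟩)
        obtain ⟨Q, hQ, hQJ⟩ := hF J hJ
        exact ⟨Q, Finset.mem_union_left _ hQ, cyl_anti (hQJ.trans hJw) hxw.1⟩
    have h1 := hI _ hcov
    have h2 := cost_union_le b F F₀
    linarith

/-- A large length gap `m` meets both requirements of `exists_monotone_adm`; it depends on `a`, `θ`
and `b - b₀`. -/
lemma Big.exists_step {a b₀ b θ : ℝ} (ha : 0 < a) (hb₀ : b₀ < b) (hb : 0 ≤ b) (hθ0 : 0 ≤ θ)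
    (hθ : θ < 1) {K : Set (ℕ → A)} (hK : IsClosed K) {I : List A} (hI : Big b K I) :
    ∃ T : ℝ → Finset (List A), Monotone T ∧ (∀ α, (T α).Nonempty) ∧
      (∀ α, ∀ J ∈ T α, I <+: J ∧ I.length + 1 ≤ J.length ∧ Big b K J) ∧
      (∀ α, Incomparable (T α)) ∧ (∀ α, 0 ≤ α → Adm α I (T α)) ∧
      ∀ α, a ≤ α → α ≤ b₀ → θ * wt α I ≤ cost α (T α) := by
  have hlim : Filter.Tendsto (fun m : ℕ => (2 : ℝ) ^ (-(a / 2 * m))) Filter.atTop (nhds 0) := by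
    have h1 := tendsto_pow_atTop_nhds_zero_of_lt_one (r := (2 : ℝ) ^ (-(a / 2)))
      (by positivity) (Real.rpow_lt_one_of_one_lt_of_neg one_lt_two (by linarith))
    refine h1.congr fun m => ?_
    rw [← Real.rpow_natCast, ← Real.rpow_mul two_pos.le, neg_mul]
  obtain ⟨m, hm1, hm2, hm3⟩ := ((hlim.eventually_le_const
    (show (0 : ℝ) < 1 - (1 + θ) / 2 by linarith)).and ((Filter.eventually_ge_atTop 1).and
      (Filter.eventually_ge_atTop ⌈2 / (b - b₀)⌉₊))).exists
  have hm : 2 ≤ (b - b₀) * m := by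
    have := Nat.le_of_ceil_le hm3
    rwa [div_le_iff₀' (by linarith)] at this
  obtain ⟨P, hP, hPJ, hPF⟩ := hI.exists_family hb hK m
  obtain ⟨T, h1, h2, h3, h4⟩ := exists_monotone_adm ha hb₀.le hm hθ0 hθ hm1
    (fun J hJ => (hPJ J hJ).1) (fun J hJ => (hPJ J hJ).2.1) hPF
  refine ⟨T, h1, fun α => (h2 α).2, fun α J hJ => ?_, fun α v hv w hw => ?_, h3, h4⟩
  · obtain ⟨i1, i2, i3⟩ := hPJ J ((h2 α).1 hJ)
    exact ⟨i1, by omega, i3⟩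
  · exact hP v ((h2 α).1 hv) w ((h2 α).1 hw)

/-- A closed set with a big word contains an increasing family of closed sets, whose members
have positive and finite content in their own dimension. -/
theorem exists_monotone_sets {b₀ b : ℝ} (hb₀ : b₀ < b) (hb : 0 ≤ b) {K : Set (ℕ → A)}
    (hK : IsClosed K) {I₀ : List A} (hI₀ : Big b K I₀) :
    ∃ E : ℝ → Set (ℕ → A), Monotone E ∧ ∀ α, 0 < α → α ≤ b₀ →
      IsCompact (E α) ∧ E α ⊆ K ∧
      (∃ c > 0, ∀ F, Covers F (E α) → c ≤ cost α F) ∧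
      ∀ n : ℕ, ∃ F, Covers F (E α) ∧ (∀ w ∈ F, n ≤ w.length) ∧ cost α F ≤ 1 := by
  -- The retention factors `f (j + 1) / f j` telescope, and their products stay above `1 / 2`.
  let f : ℕ → ℝ := fun j => 1 + (1 / 2) ^ j
  have hf0 : ∀ j, 0 < f j := fun j => by positivity
  have hfanti : ∀ j, f (j + 1) < f j := fun j => by
    have : (0 : ℝ) < (1 / 2) ^ j := by positivity
    simp only [f, pow_succ]
    linarith
  -- Level `j` controls mass loss only for `α ≥ 1 / (j + 1)`, which covers each positive `α` from
  -- some level on. Nonemptiness at the earlier levels leaves positive mass to start from.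
  have hstep : ∀ (j : ℕ) (I : List A), ∃ T : ℝ → Finset (List A), Big b K I →
      Monotone T ∧ (∀ α, (T α).Nonempty) ∧
      (∀ α, ∀ J ∈ T α, I <+: J ∧ I.length + 1 ≤ J.length ∧ Big b K J) ∧
      (∀ α, Incomparable (T α)) ∧ (∀ α, 0 ≤ α → Adm α I (T α)) ∧
      ∀ α, 1 / ((j : ℝ) + 1) ≤ α → α ≤ b₀ → f (j + 1) / f j * wt α I ≤ cost α (T α) := by
    intro j I
    by_cases hI : Big b K I
    · obtain ⟨T, hT⟩ := hI.exists_step (a := 1 / ((j : ℝ) + 1)) (θ := f (j + 1) / f j)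
        (by positivity) hb₀ hb (div_pos (hf0 _) (hf0 _)).le ((div_lt_one (hf0 j)).2 (hfanti j)) hK
      exact ⟨T, fun _ => hT⟩
    · exact ⟨fun _ => ∅, fun h => (hI h).elim⟩
  choose T hT using hstep
  let G : ℕ → ℝ → Finset (List A) := fun j α =>
    Nat.rec {I₀} (fun j g => g.biUnion fun I => T j I α) j
  have hGs : ∀ j α, G (j + 1) α = (G j α).biUnion fun I => T j I α := fun _ _ => rfl
  have hG0 : ∀ α, G 0 α = {I₀} := fun _ => rfl
  have hBig : ∀ j α, ∀ J ∈ G j α, Big b K J ∧ j ≤ J.length := by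
    intro j α
    induction j with
    | zero => simpa [hG0] using hI₀
    | succ j ih =>
      intro J hJ
      obtain ⟨I, hI, hJI⟩ := Finset.mem_biUnion.1 (hGs j α ▸ hJ)
      obtain ⟨-, h2, h3⟩ := (hT j I (ih I hI).1).2.2.1 α J hJI
      exact ⟨h3, by have := (ih I hI).2; omega⟩
  have hne : ∀ j α, (G j α).Nonempty := by
    intro j α
    induction j with
    | zero => simp [hG0]
    | succ j ih =>
      obtain ⟨I, hI⟩ := ih
      obtain ⟨J, hJ⟩ := (hT j I (hBig j α I hI).1).2.1 α
      exact ⟨J, hGs j α ▸ Finset.mem_biUnion.2 ⟨I, hI, hJ⟩⟩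
  have hpre : ∀ j α, ∀ I ∈ G j α, ∀ J ∈ T j I α, I <+: J := fun j α I hI J hJ =>
    ((hT j I (hBig j α I hI).1).2.2.1 α J hJ).1
  have hinc : ∀ j α, Incomparable (G j α) := by
    intro j α
    induction j with
    | zero =>
      intro v hv w hw _
      rw [hG0, Finset.mem_singleton] at hv hw
      rw [hv, hw]
    | succ j ih =>
      intro v hv w hw hvw
      obtain ⟨I, hI, hvI⟩ := Finset.mem_biUnion.1 (hGs j α ▸ hv)
      obtain ⟨I', hI', hwI⟩ := Finset.mem_biUnion.1 (hGs j α ▸ hw)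
      have hII : I = I' := by
        rcases prefix_or_prefix ((hpre j α I hI v hvI).trans hvw) (hpre j α I' hI' w hwI)
          with h | h
        · exact ih I hI I' hI' h
        · exact (ih I' hI' I hI h).symm
      subst hII
      exact (hT j I (hBig j α I hI).1).2.2.2.1 α v hvI w hwI hvw
  have hadm : ∀ j α, 0 ≤ α → ∀ I ∈ G j α, Adm α I (T j I α) := fun j α hα I hI =>
    (hT j I (hBig j α I hI).1).2.2.2.2.1 α hα
  have hle : ∀ j α, 0 ≤ α → cost α (G (j + 1) α) ≤ cost α (G j α) := by
    intro j α hα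
    rw [hGs]
    exact (cost_biUnion_le _ _ _).trans (Finset.sum_le_sum fun I hI => (hadm j α hα I hI).total)
  have hanti : ∀ α, 0 ≤ α → Antitone fun j => cost α (G j α) := fun α hα =>
    antitone_nat_of_succ_le fun j => hle j α hα
  have hle1 : ∀ j α, 0 ≤ α → cost α (G j α) ≤ 1 := by
    intro j α hα
    refine (hanti α hα (Nat.zero_le j)).trans ?_
    simpa [hG0, cost] using wt_le_one hα I₀
  have hlocal : ∀ j α, 0 ≤ α → ∀ Q, cost α (below (G j α) Q) ≤ 5 * wt α Q := by
    intro j α hα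
    induction j with
    | zero =>
      intro Q
      have hQ0 := wt_pos α Q
      by_cases h : Q <+: I₀
      · have := wt_anti hα h.length_le
        simp only [hG0, below, Finset.filter_singleton, h, if_true, cost, Finset.sum_singleton]
        linarith
      · simp only [hG0, below, Finset.filter_singleton, h, if_false, cost, Finset.sum_empty]
        linarith
    | succ j ih =>
      intro Q
      -- If `Q` lies below a selected `I`, the bound is that of the new step inside `I`. Otherwise
      -- refining the words below `Q` does not increase their total mass.
      by_cases h : ∃ I ∈ G j α, I <+: Q
      · obtain ⟨I, hI, hIQ⟩ := h
        refine (cost_mono α fun J hJ => ?_).trans ((hadm j α hα I hI).local_le Q hIQ)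
        obtain ⟨hJ, hQJ⟩ := mem_below.1 hJ
        obtain ⟨I', hI', hJI⟩ := Finset.mem_biUnion.1 (hGs j α ▸ hJ)
        have hII : I = I' := by
          rcases prefix_or_prefix (hIQ.trans hQJ) (hpre j α I' hI' J hJI) with h | h
          · exact hinc j α I hI I' hI' h
          · exact (hinc j α I' hI' I hI h).symm
        subst hII
        exact mem_below.2 ⟨hJI, hQJ⟩
      · calc cost α (below (G (j + 1) α) Q)
            ≤ cost α ((below (G j α) Q).biUnion fun I => T j I α) := by
              refine cost_mono α fun J hJ => ?_
              obtain ⟨hJ, hQJ⟩ := mem_below.1 hJ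
              obtain ⟨I, hI, hJI⟩ := Finset.mem_biUnion.1 (hGs j α ▸ hJ)
              refine Finset.mem_biUnion.2 ⟨I, mem_below.2 ⟨hI, ?_⟩, hJI⟩
              exact (prefix_or_prefix hQJ (hpre j α I hI J hJI)).resolve_right
                fun h' => h ⟨I, hI, h'⟩
          _ ≤ cost α (below (G j α) Q) :=
              (cost_biUnion_le _ _ _).trans (Finset.sum_le_sum fun I hI =>
                (hadm j α hα I (mem_below.1 hI).1).total)
          _ ≤ 5 * wt α Q := ih Q
  have hge : ∀ (j : ℕ) (α : ℝ), 1 / ((j : ℝ) + 1) ≤ α → α ≤ b₀ →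
      f (j + 1) / f j * cost α (G j α) ≤ cost α (G (j + 1) α) := by
    intro j α hα hαb
    have hsum : cost α (G (j + 1) α) = ∑ I ∈ G j α, cost α (T j I α) := by
      rw [hGs, cost, Finset.sum_biUnion]
      · rfl
      · intro I hI I' hI' hne
        refine Finset.disjoint_left.2 fun J hJ hJ' => hne ?_
        rcases prefix_or_prefix (hpre j α I hI J hJ) (hpre j α I' hI' J hJ') with h | h
        · exact hinc j α I hI I' hI' h
        · exact (hinc j α I' hI' I hI h).symm
    rw [hsum, cost, Finset.mul_sum]
    exact Finset.sum_le_sum fun I hI => (hT j I (hBig j α I hI).1).2.2.2.2.2 α hα hαb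
  have hGmono : ∀ j, Monotone (G j) := by
    intro j α β hαβ
    induction j with
    | zero => exact le_rfl
    | succ j ih =>
      intro J hJ
      obtain ⟨I, hI, hJI⟩ := Finset.mem_biUnion.1 (hGs j α ▸ hJ)
      rw [hGs]
      exact Finset.mem_biUnion.2 ⟨I, ih hI, (hT j I (hBig j α I hI).1).1 hαβ hJI⟩
  let D : ℝ → ℕ → Set (ℕ → A) := fun α j => K ∩ {x | ∃ w ∈ G j α, x ∈ cyl w}
  have hDclosed : ∀ α j, IsClosed (D α j) := fun α j => hK.inter (isClopen_cover _).isClosed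
  have hDanti : ∀ α, Antitone (D α) := fun α => antitone_nat_of_succ_le fun j x hx => by
    obtain ⟨hxK, J, hJ, hxJ⟩ := hx
    obtain ⟨I, hI, hJI⟩ := Finset.mem_biUnion.1 (hGs j α ▸ hJ)
    exact ⟨hxK, I, hI, cyl_anti (hpre j α I hI J hJI) hxJ⟩
  refine ⟨fun α => ⋂ j, D α j, fun α β hαβ => Set.iInter_mono fun j x hx => ?_,
    fun α hα hαb => ⟨(isClosed_iInter (hDclosed α)).isCompact,
      (Set.iInter_subset _ 0).trans Set.inter_subset_left, ?_, fun n => ?_⟩⟩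
  · obtain ⟨hxK, w, hw, hxw⟩ := hx
    exact ⟨hxK, w, hGmono j hαβ hw, hxw⟩
  · obtain ⟨N, hN⟩ := exists_nat_one_div_lt hα
    have hlow : ∀ j, cost α (G N α) / 2 ≤ cost α (G j α) := by
      have hc0 := cost_nonneg α (G N α)
      intro j
      rcases le_total j N with hj | hj
      · have : cost α (G N α) ≤ cost α (G j α) := hanti α hα.le hj
        linarith
      · have h1 : ∀ j ≥ N, f j * cost α (G N α) ≤ f N * cost α (G j α) := by
          intro j hj
          induction j, hj using Nat.le_induction with
          | base => exact le_rfl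
          | succ j hj ih =>
            have h2 : 1 / ((j : ℝ) + 1) ≤ α := by
              refine le_trans ?_ hN.le
              gcongr
            have h3 := hge j α h2 hαb
            rw [div_mul_eq_mul_div, div_le_iff₀ (hf0 j)] at h3
            have h4 := mul_le_mul_of_nonneg_left ih (hf0 (j + 1)).le
            have h5 := mul_le_mul_of_nonneg_left h3 (hf0 N).le
            refine le_of_mul_le_mul_right ?_ (hf0 j)
            linarith
        have h2 : f N ≤ 2 := by
          have : ((1 : ℝ) / 2) ^ N ≤ 1 := pow_le_one₀ (by norm_num) (by norm_num)
          simp only [f]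
          linarith
        have h3 : 1 ≤ f j := by
          have : (0 : ℝ) < (1 / 2) ^ j := by positivity
          simp only [f]
          linarith
        have h4 := h1 j hj
        have h5 := cost_nonneg α (G j α)
        nlinarith
    refine ⟨cost α (G N α) / 2 / 5, ?_, fun F hF => ?_⟩
    · obtain ⟨w, hw⟩ := hne N α
      have := (wt_pos α w).trans_le (wt_le_cost α hw)
      positivity
    -- By compactness a cover of the limit set already covers a finite stage. Past the longest word
    -- of `F`, each selected word extends a word of `F`, so the local bounds apply.
    · obtain ⟨j₀, hj₀⟩ := exists_subset_nhds_of_isCompact' (hDanti α).directed_ge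
        (fun j => (hDclosed α j).isCompact) (hDclosed α)
        (U := {x | ∃ w ∈ F, x ∈ cyl w})
        (fun x hx => (isClopen_cover F).isOpen.mem_nhds (hF x hx))
      set j := max j₀ (F.sup List.length)
      have hsub : G j α ⊆ F.biUnion fun Q => below (G j α) Q := by
        intro J hJ
        obtain ⟨x, hxK, hxJ⟩ := (hBig j α J hJ).1.nonempty
        obtain ⟨Q, hQ, hxQ⟩ := hj₀ (hDanti α (le_max_left _ _) ⟨hxK, J, hJ, hxJ⟩)
        have hl : Q.length ≤ J.length := (Finset.le_sup (f := List.length) hQ).trans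
          ((le_max_right _ _).trans (hBig j α J hJ).2)
        exact Finset.mem_biUnion.2 ⟨Q, hQ, mem_below.2 ⟨hJ, prefix_of_mem_cyl hxQ hxJ hl⟩⟩
      have h1 : cost α (G j α) ≤ 5 * cost α F := by
        refine (cost_mono α hsub).trans ((cost_biUnion_le _ _ _).trans ?_)
        rw [cost, Finset.mul_sum]
        exact Finset.sum_le_sum fun Q _ => hlocal j α hα.le Q
      have h2 := hlow j
      linarith
  · exact ⟨G n α, fun x hx => (Set.mem_iInter.1 hx n).2, fun w hw => (hBig n α w hw).2,
      hle1 n α hα.le⟩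

end CodeTree

/-! ### Comparing covering costs with Hausdorff measure. -/

namespace CodeTree

open MeasureTheory Metric

section Transfer

variable {A Y : Type*} [MetricSpace Y] {π : (ℕ → A) → Y}

/-- The scale `2 ^ (-k)` is matched to the diameter of `t`. The slack `η` is for sets of diameter
zero, where `k` is merely taken large. -/
lemma exists_cover_preimage {c α η : ℝ} {C : ℕ} (hc : 0 < c) (hα : 0 < α) (hη : 0 < η)
    (hπ : ∀ (k : ℕ) (t : Set Y), ediam t < ENNReal.ofReal (c / 2 ^ k) →
      ∃ F : Finset (List A), Covers F (π ⁻¹' t) ∧ (∀ w ∈ F, w.length = k) ∧ F.card ≤ C)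
    {t : Set Y} (ht : ediam t ≤ ENNReal.ofReal (c / 2)) :
    ∃ F : Finset (List A), Covers F (π ⁻¹' t) ∧
      cost α F ≤ C * ((4 / c) ^ α * (⨆ _ : t.Nonempty, ediam t ^ α).toReal + η) := by
  rcases t.eq_empty_or_nonempty with rfl | hne
  · refine ⟨∅, by simp [Covers], ?_⟩
    simp only [cost, Finset.sum_empty]
    positivity
  have hfin : ediam t ≠ ⊤ := ne_top_of_le_ne_top ENNReal.ofReal_ne_top ht
  set δ := (ediam t).toReal with hδ
  have hδ0 : 0 ≤ δ := ENNReal.toReal_nonneg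
  have hδc : δ ≤ c / 2 := ENNReal.toReal_le_of_le_ofReal (by positivity) ht
  have hval : (⨆ _ : t.Nonempty, ediam t ^ α).toReal = δ ^ α := by
    rw [ciSup_pos hne, ← ENNReal.toReal_rpow]
  obtain ⟨k, hk1, hk2⟩ : ∃ k : ℕ, δ < c / 2 ^ k ∧
      (2 : ℝ) ^ (-(α * k)) ≤ (4 / c) ^ α * δ ^ α + η := by
    rcases hδ0.eq_or_lt with h0 | h0
    · have hlim : Filter.Tendsto (fun k : ℕ => (2 : ℝ) ^ (-(α * k))) Filter.atTop (nhds 0) := by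
        have h1 := tendsto_pow_atTop_nhds_zero_of_lt_one (r := (2 : ℝ) ^ (-α))
          (by positivity) (Real.rpow_lt_one_of_one_lt_of_neg one_lt_two (by linarith))
        refine h1.congr fun m => ?_
        rw [← Real.rpow_natCast, ← Real.rpow_mul two_pos.le, neg_mul]
      obtain ⟨k, hk⟩ := (hlim.eventually_le_const hη).exists
      refine ⟨k, by rw [← h0]; positivity, hk.trans ?_⟩
      have : 0 ≤ (4 / c) ^ α * δ ^ α := by positivity
      linarith
    · obtain ⟨k, hk1, hk2⟩ := exists_nat_pow_near (x := c / 2 / δ) (y := 2)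
        ((one_le_div h0).2 hδc) one_lt_two
      rw [le_div_iff₀ h0] at hk1
      rw [div_lt_iff₀ h0, pow_succ] at hk2
      refine ⟨k, ?_, ?_⟩
      · rw [lt_div_iff₀ (by positivity)]
        linarith
      · rw [← Real.mul_rpow (by positivity) hδ0]
        have : (2 : ℝ) ^ (-(α * k)) = ((2 ^ k)⁻¹ : ℝ) ^ α := by
          rw [← Real.rpow_natCast, ← Real.rpow_neg two_pos.le, ← Real.rpow_mul two_pos.le]
          congr 1
          ring
        rw [this]
        have h2 : ((2 ^ k)⁻¹ : ℝ) ≤ 4 / c * δ := by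
          rw [inv_le_iff_one_le_mul₀ (by positivity), div_mul_eq_mul_div, div_mul_eq_mul_div,
            le_div_iff₀ hc]
          linarith
        have := Real.rpow_le_rpow (by positivity) h2 hα.le
        linarith
  obtain ⟨F, hF, hlen, hcard⟩ := hπ k t ((ENNReal.lt_ofReal_iff_toReal_lt hfin).2 hk1)
  refine ⟨F, hF, ?_⟩
  rw [hval]
  have hpos : 0 ≤ (4 / c) ^ α * δ ^ α + η := by positivity
  calc cost α F = F.card * (2 : ℝ) ^ (-(α * k)) := by
        rw [cost, Finset.sum_congr rfl fun w hw => by rw [wt, hlen w hw], Finset.sum_const,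
          nsmul_eq_mul]
    _ ≤ C * ((4 / c) ^ α * δ ^ α + η) := by gcongr

variable [MeasurableSpace Y] [BorelSpace Y]

lemma hausdorffMeasure_image_le {D α C : ℝ} (hD : 0 ≤ D) (hα : 0 < α)
    (hπ : ∀ w : List A, ediam (π '' cyl w) ≤ ENNReal.ofReal (D / 2 ^ w.length))
    {S : Set (ℕ → A)}
    (hS : ∀ n : ℕ, ∃ F, Covers F S ∧ (∀ w ∈ F, n ≤ w.length) ∧ cost α F ≤ C) :
    μH[α] (π '' S) ≤ ENNReal.ofReal (D ^ α * C) := by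
  choose F hF hlen hcost using hS
  have hr : Filter.Tendsto (fun n : ℕ => ENNReal.ofReal (D / 2 ^ n)) Filter.atTop (nhds 0) := by
    have h1 : Filter.Tendsto (fun n : ℕ => D / 2 ^ n) Filter.atTop (nhds 0) := by
      have := (tendsto_pow_atTop_nhds_zero_of_lt_one (r := (1 / 2 : ℝ)) (by norm_num)
        (by norm_num)).const_mul D
      rw [mul_zero] at this
      exact this.congr fun n => by rw [one_div, inv_pow, div_eq_mul_inv]
    simpa using ENNReal.tendsto_ofReal h1
  refine (Measure.hausdorffMeasure_le_liminf_sum α (π '' S) _ hr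
    (fun n (w : F n) => π '' cyl w.1) (.of_forall fun n w => (hπ w).trans ?_)
    (.of_forall fun n => ?_)).trans ?_
  · apply ENNReal.ofReal_le_ofReal
    have := hlen n w w.2
    gcongr
    exact one_le_two
  · rintro _ ⟨x, hx, rfl⟩
    obtain ⟨w, hw, hxw⟩ := hF n x hx
    exact Set.mem_iUnion.2 ⟨⟨w, hw⟩, x, hxw, rfl⟩
  · refine (Filter.liminf_le_liminf (v := fun _ => ENNReal.ofReal (D ^ α * C))
      (.of_forall fun n => ?_)).trans_eq (Filter.liminf_const _)
    calc ∑ w : F n, ediam (π '' cyl w.1) ^ α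
        ≤ ∑ w : F n, ENNReal.ofReal (D ^ α * wt α w.1) := by
          refine Finset.sum_le_sum fun w _ => ?_
          refine (ENNReal.rpow_le_rpow (hπ w) hα.le).trans_eq ?_
          rw [ENNReal.ofReal_rpow_of_nonneg (by positivity) hα.le,
            Real.div_rpow hD (by positivity), wt, div_eq_mul_inv, ← Real.rpow_natCast,
            ← Real.rpow_mul two_pos.le, ← Real.rpow_neg two_pos.le, mul_comm (_ : ℝ) α]
      _ = ENNReal.ofReal (D ^ α * cost α (F n)) := by
          rw [← ENNReal.ofReal_sum_of_nonneg fun w _ =>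
            mul_nonneg (Real.rpow_nonneg hD _) (wt_pos _ _).le, ← Finset.mul_sum,
            Finset.sum_coe_sort (F n) (wt α), cost]
      _ ≤ _ := ENNReal.ofReal_le_ofReal
          (mul_le_mul_of_nonneg_left (hcost n) (Real.rpow_nonneg hD _))

variable [DecidableEq A] [TopologicalSpace A] [DiscreteTopology A]

lemma hausdorffMeasure_image_pos {c α c₀ : ℝ} {C : ℕ} (hc : 0 < c) (hα : 0 < α) (hc₀ : 0 < c₀)
    (hπ : ∀ (k : ℕ) (t : Set Y), ediam t < ENNReal.ofReal (c / 2 ^ k) →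
      ∃ F : Finset (List A), Covers F (π ⁻¹' t) ∧ (∀ w ∈ F, w.length = k) ∧ F.card ≤ C)
    {S : Set (ℕ → A)} (hS : IsCompact S) (hcost : ∀ F, Covers F S → c₀ ≤ cost α F) :
    0 < μH[α] (π '' S) := by
  rw [pos_iff_ne_zero]
  intro h0
  set B : ℝ := (4 / c) ^ α
  have hB : 0 < B := by positivity
  -- The term `2 * ε` is room for the slacks `ε * (1 / 2) ^ n` of the individual covering sets.
  obtain ⟨ε, hε, hεc⟩ : ∃ ε : ℝ, 0 < ε ∧ C * (B * ε + 2 * ε) < c₀ := by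
    refine ⟨c₀ / (2 * (C + 1) * (B + 2)), by positivity, ?_⟩
    have h1 : B * (c₀ / (2 * (C + 1) * (B + 2))) + 2 * (c₀ / (2 * (C + 1) * (B + 2))) =
        c₀ / (2 * (C + 1)) := by field_simp
    rw [h1, mul_div_assoc', div_lt_iff₀ (by positivity)]
    nlinarith [(Nat.cast_nonneg C : (0 : ℝ) ≤ C)]
  rw [Measure.hausdorffMeasure_apply] at h0
  have h1 := le_iSup₂ (f := fun (r : ENNReal) (_ : 0 < r) =>
    ⨅ (t : ℕ → Set Y) (_ : π '' S ⊆ ⋃ n, t n) (_ : ∀ n, ediam (t n) ≤ r),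
          ∑' n, ⨆ _ : (t n).Nonempty, ediam (t n) ^ α) (ENNReal.ofReal (c / 2))
          (ENNReal.ofReal_pos.2 (half_pos hc))
  rw [h0] at h1
  have h2 := h1.trans_lt (ENNReal.ofReal_pos.2 hε)
  simp only [iInf_lt_iff] at h2
  obtain ⟨t, htS, htd, htε⟩ := h2
  choose F hF hFc using fun n : ℕ => exists_cover_preimage (α := α) (η := ε * (1 / 2) ^ n)
    hc hα (by positivity) hπ (htd n)
  obtain ⟨s, hs⟩ := hS.elim_finite_subcover (fun n => {x : ℕ → A | ∃ w ∈ F n, x ∈ cyl w})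
    (fun n => (isClopen_cover (F n)).isOpen) (fun x hx => by
      obtain ⟨n, hn⟩ := Set.mem_iUnion.1 (htS (Set.mem_image_of_mem π hx))
      exact Set.mem_iUnion.2 ⟨n, hF n x hn⟩)
  have hcov : Covers (s.biUnion F) S := fun x hx => by
    obtain ⟨n, hn, w, hw, hxw⟩ := Set.mem_iUnion₂.1 (hs hx)
    exact ⟨w, Finset.mem_biUnion.2 ⟨n, hn, hw⟩, hxw⟩
  let v : ℕ → ENNReal := fun n => ⨆ _ : (t n).Nonempty, ediam (t n) ^ α
  have hv : ∑ n ∈ s, (v n).toReal ≤ ε := by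
    have hle : ∑ n ∈ s, v n ≤ ENNReal.ofReal ε := (ENNReal.sum_le_tsum s).trans htε.le
    rw [← ENNReal.toReal_sum fun n hn => ne_top_of_le_ne_top ENNReal.ofReal_ne_top
      ((Finset.single_le_sum (fun _ _ => zero_le) hn).trans hle)]
    exact ENNReal.toReal_le_of_le_ofReal hε.le hle
  have hgeom : ∑ n ∈ s, (1 / 2 : ℝ) ^ n ≤ 2 := by
    exact (summable_geometric_two.sum_le_tsum s fun _ _ => by positivity).trans_eq
      tsum_geometric_two
  have h3 : cost α (s.biUnion F) ≤ C * (B * ε + 2 * ε) := by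
    calc cost α (s.biUnion F) ≤ ∑ n ∈ s, cost α (F n) := cost_biUnion_le _ _ _
      _ ≤ ∑ n ∈ s, C * (B * (v n).toReal + ε * (1 / 2) ^ n) := Finset.sum_le_sum fun n _ => hFc n
      _ = C * (B * ∑ n ∈ s, (v n).toReal + ε * ∑ n ∈ s, (1 / 2 : ℝ) ^ n) := by
          rw [← Finset.mul_sum, Finset.sum_add_distrib, Finset.mul_sum, Finset.mul_sum]
      _ ≤ C * (B * ε + ε * 2) := by gcongr
      _ = C * (B * ε + 2 * ε) := by ring
  exact absurd (hcost _ hcov) (not_le.2 (h3.trans_lt hεc))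

end Transfer

/-! ### Binary coding of a cube. -/

section Digits

/-- The integer with the first `k` binary digits of `u`. -/
def num (u : ℕ → Fin 2) : ℕ → ℕ
  | 0 => 0
  | k + 1 => 2 * num u k + u k

lemma eq_of_num_eq {u v : ℕ → Fin 2} {k : ℕ} (h : num u k = num v k) :
    ∀ i < k, u i = v i := by
  induction k with
  | zero => simp
  | succ k ih =>
    simp only [num] at h
    have hu := (u k).isLt
    have hv := (v k).isLt
    intro i hi
    rcases Nat.lt_succ_iff_lt_or_eq.1 hi with hi | rfl
    · exact ih (by omega) i hi
    · exact Fin.ext (by omega)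

lemma sum_ofDigitsTerm_eq (u : ℕ → Fin 2) (k : ℕ) :
    ∑ i ∈ Finset.range k, Real.ofDigitsTerm u i = num u k / 2 ^ k := by
  induction k with
  | zero => simp [num]
  | succ k ih =>
    rw [Finset.sum_range_succ, ih, Real.ofDigitsTerm, num]
    push_cast
    field_simp
    ring

/-- After scaling by `2 ^ k` the tails lie in `[0, 1]`, so the integer parts differ by less than 2.
-/
lemma abs_num_sub_lt {u v : ℕ → Fin 2} {k : ℕ}
    (h : |Real.ofDigits u - Real.ofDigits v| < 1 / 2 ^ k) :
    |(num u k : ℤ) - num v k| ≤ 1 := by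
  rw [Real.ofDigits_eq_sum_add_ofDigits u k, Real.ofDigits_eq_sum_add_ofDigits v k,
    sum_ofDigitsTerm_eq, sum_ofDigitsTerm_eq] at h
  have hu0 := Real.ofDigits_nonneg fun i => u (i + k)
  have hu1 := Real.ofDigits_le_one fun i => u (i + k)
  have hv0 := Real.ofDigits_nonneg fun i => v (i + k)
  have hv1 := Real.ofDigits_le_one fun i => v (i + k)
  set p := Real.ofDigits fun i => u (i + k)
  set q := Real.ofDigits fun i => v (i + k)
  have h2 : (0 : ℝ) < 2 ^ k := by positivity
  have h3 : |(num u k : ℝ) - num v k + (p - q)| < 1 := by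
    have : (num u k : ℝ) / 2 ^ k + ((2 : ℕ) ^ k : ℝ)⁻¹ * p -
        (num v k / 2 ^ k + ((2 : ℕ) ^ k : ℝ)⁻¹ * q) =
        ((num u k : ℝ) - num v k + (p - q)) / 2 ^ k := by
      push_cast
      field_simp
      ring
    rw [this, abs_div, abs_of_pos h2, div_lt_div_iff_of_pos_right h2] at h
    exact h
  rw [abs_lt] at h3
  have h4 : ((num u k : ℤ) - num v k : ℝ) < 2 := by push_cast; linarith
  have h5 : (-2 : ℝ) < ((num u k : ℤ) - num v k : ℝ) := by push_cast; linarith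
  have h4' : (num u k : ℤ) - num v k < 2 := by exact_mod_cast h4
  have h5' : (-2 : ℤ) < (num u k : ℤ) - num v k := by exact_mod_cast h5
  rw [abs_le]
  omega

variable {d : ℕ}

/-- The point of the cube `[-R, R]^d` whose coordinates have the given binary digits. -/
noncomputable def decode (R : ℝ) (x : ℕ → Fin d → Fin 2) : EuclideanSpace ℝ (Fin d) :=
  WithLp.toLp 2 fun i => R * (2 * Real.ofDigits (fun n => x n i) - 1)

lemma decode_apply (R : ℝ) (x : ℕ → Fin d → Fin 2) (i : Fin d) :
    decode R x i = R * (2 * Real.ofDigits (fun n => x n i) - 1) := rfl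

lemma continuous_decode (R : ℝ) : Continuous (decode R : (ℕ → Fin d → Fin 2) → _) := by
  refine (PiLp.continuous_toLp 2 _).comp (continuous_pi fun i => ?_)
  have : Continuous fun x : ℕ → Fin d → Fin 2 => Real.ofDigits fun n => x n i :=
    Real.continuous_ofDigits.comp (by fun_prop)
  fun_prop

lemma exists_decode_eq {R : ℝ} (hR : 0 < R) {y : EuclideanSpace ℝ (Fin d)} (hy : ‖y‖ ≤ R) :
    ∃ x, decode R x = y := by
  have h : ∀ i, ∃ u : ℕ → Fin 2, R * (2 * Real.ofDigits u - 1) = y i := by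
    intro i
    have hi := abs_le.1 ((PiLp.norm_apply_le y i).trans hy)
    obtain ⟨u, -, hu⟩ := Real.ofDigits_SurjOn one_lt_two
      (show (y i / R + 1) / 2 ∈ Set.Icc (0 : ℝ) 1 by
        have h1 : -1 ≤ y i / R := by rw [le_div_iff₀ hR]; linarith [hi.1]
        have h2 : y i / R ≤ 1 := by rw [div_le_iff₀ hR]; linarith [hi.2]
        constructor <;> linarith)
    refine ⟨u, ?_⟩
    rw [hu]
    field_simp
    ring
  choose u hu using h
  exact ⟨fun n i => u i n, PiLp.ext hu⟩

lemma ediam_decode_cyl_le {R : ℝ} (hR : 0 < R) (w : List (Fin d → Fin 2)) :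
    ediam (decode R '' cyl w) ≤ ENNReal.ofReal (d * (2 * R) / 2 ^ w.length) := by
  refine ediam_le ?_
  rintro _ ⟨x, hx, rfl⟩ _ ⟨y, hy, rfl⟩
  rw [edist_dist]
  apply ENNReal.ofReal_le_ofReal
  have hxy := pre_eq_pre_iff.1 (Eq.trans hx (Eq.symm hy) : pre x w.length = pre y w.length)
  have hcoord : ∀ i, |decode R x i - decode R y i| ≤ 2 * R / 2 ^ w.length := by
    intro i
    have := Real.abs_ofDigits_sub_ofDigits_le (x := fun n => x n i) (y := fun n => y n i)
      (n := w.length) fun n hn => by rw [hxy n hn]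
    rw [decode_apply, decode_apply, ← mul_sub, sub_sub_sub_cancel_right, ← mul_sub, abs_mul,
      abs_mul, abs_of_pos hR, abs_of_pos two_pos, div_eq_mul_inv]
    push_cast at this
    nlinarith
  rw [EuclideanSpace.dist_eq, Real.sqrt_le_left (by positivity)]
  calc ∑ i, dist (decode R x i) (decode R y i) ^ 2
      ≤ ∑ i : Fin d, (2 * R / 2 ^ w.length) ^ 2 := by
        refine Finset.sum_le_sum fun i _ => ?_
        rw [Real.dist_eq]
        exact pow_le_pow_left₀ (abs_nonneg _) (hcoord i) 2
    _ = d * (2 * R / 2 ^ w.length) ^ 2 := by simp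
    _ ≤ d ^ 2 * (2 * R / 2 ^ w.length) ^ 2 := by
        gcongr
        exact_mod_cast Nat.le_self_pow two_ne_zero d
    _ = (d * (2 * R) / 2 ^ w.length) ^ 2 := by ring

lemma exists_cover_preimage_decode {R : ℝ} (hR : 0 < R) (k : ℕ)
    {t : Set (EuclideanSpace ℝ (Fin d))} (ht : ediam t < ENNReal.ofReal (2 * R / 2 ^ k)) :
    ∃ F : Finset (List (Fin d → Fin 2)), Covers F (decode R ⁻¹' t) ∧
      (∀ w ∈ F, w.length = k) ∧ F.card ≤ 3 ^ d := by
  classical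
  rcases (decode R ⁻¹' t).eq_empty_or_nonempty with he | ⟨y, hy⟩
  · exact ⟨∅, by simp [he, Covers], by simp, by simp⟩
  obtain ⟨U, hU, hUk⟩ := exists_cover_of_length (decode R ⁻¹' t) k
  -- Only words that meet the preimage are kept. Such a word is determined by its `d` coordinate
  -- integers, each within 1 of that of the fixed point `y`, hence the count `3 ^ d`.
  let F := U.filter fun w => ∃ x ∈ decode R ⁻¹' t, pre x k = w
  have hnum : ∀ x ∈ decode R ⁻¹' t, ∀ i,
      |(num (fun n => x n i) k : ℤ) - num (fun n => y n i) k| ≤ 1 := by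
    intro x hx i
    apply abs_num_sub_lt
    have h1 : dist (decode R x) (decode R y) < 2 * R / 2 ^ k := by
      have := (edist_le_ediam_of_mem (show decode R x ∈ t from hx) hy).trans_lt ht
      rw [edist_dist] at this
      exact (ENNReal.ofReal_lt_ofReal_iff (by positivity)).1 this
    rw [dist_eq_norm] at h1
    have h2 := (PiLp.norm_apply_le (decode R x - decode R y) i).trans_lt h1
    rw [PiLp.sub_apply, decode_apply, decode_apply, ← mul_sub, sub_sub_sub_cancel_right,
      ← mul_sub, Real.norm_eq_abs, abs_mul, abs_mul, abs_of_pos hR, abs_of_pos two_pos,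
      ← mul_assoc, mul_comm R 2, div_eq_mul_one_div] at h2
    exact lt_of_mul_lt_mul_left h2 (by positivity)
  have hex : ∀ w ∈ F, ∃ x ∈ decode R ⁻¹' t, pre x k = w := fun w hw => (Finset.mem_filter.1 hw).2
  choose! r hr hrw using hex
  refine ⟨F, fun x hx => ?_, fun w hw => hUk w (Finset.mem_filter.1 hw).1, ?_⟩
  · obtain ⟨w, hw, hxw⟩ := hU x hx
    refine ⟨w, Finset.mem_filter.2 ⟨hw, x, hx, ?_⟩, hxw⟩
    rw [← hUk w hw]
    exact hxw
  · calc F.card ≤ (Fintype.piFinset fun _ : Fin d => Finset.Icc (-1 : ℤ) 1).card := by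
          refine Finset.card_le_card_of_injOn
            (fun w i => (num (fun n => r w n i) k : ℤ) - num (fun n => y n i) k) ?_ ?_
          · intro w hw
            refine Finset.mem_coe.2 (Fintype.mem_piFinset.2 fun i => ?_)
            exact Finset.mem_Icc.2 (abs_le.1 (hnum _ (hr w hw) i))
          · intro v hv w hw hvw
            rw [← hrw v hv, ← hrw w hw, pre_eq_pre_iff]
            intro n hn
            funext i
            have := congrFun hvw i
            simp only [sub_left_inj, Nat.cast_inj] at this
            exact eq_of_num_eq this n hn
      _ = 3 ^ d := by simp

/-- Below a dimension in which the compact set `K` has positive Hausdorff measure, `K` contains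
an increasing family of compact sets of positive and finite Hausdorff measure. -/
theorem exists_monotone_of_hausdorffMeasure_ne_zero {K : Set (EuclideanSpace ℝ (Fin d))}
    (hK : IsCompact K) {b₀ b : ℝ} (hb₀ : b₀ < b) (hb : 0 < b) (hKb : μH[b] K ≠ 0) :
    ∃ E : ℝ → Set (EuclideanSpace ℝ (Fin d)), Monotone E ∧ ∀ α, 0 < α → α ≤ b₀ →
      IsCompact (E α) ∧ E α ⊆ K ∧ 0 < μH[α] (E α) ∧ μH[α] (E α) < ⊤ := by
  obtain ⟨R, hR, hKR⟩ := hK.isBounded.exists_pos_norm_le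
  have hcont := continuous_decode (d := d) R
  have hsurj : decode R '' (decode R ⁻¹' K) = K :=
    Set.image_preimage_eq_of_subset fun y hy => exists_decode_eq hR (hKR y hy)
  have hdiam := ediam_decode_cyl_le (d := d) hR
  have hD : 0 ≤ d * (2 * R) := by positivity
  obtain ⟨I₀, hI₀⟩ : ∃ I₀, Big b (decode R ⁻¹' K) I₀ := by
    -- With no big word, `K` has covers by long words of arbitrarily small `b`-cost, so its
    -- `b`-measure vanishes.
    by_contra! hcon
    refine hKb (le_antisymm ?_ zero_le)
    have h1 : ∀ η : ℝ, 0 < η → μH[b] K ≤ ENNReal.ofReal ((d * (2 * R)) ^ b * η) := by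
      intro η hη
      rw [← hsurj]
      exact hausdorffMeasure_image_le hD hb hdiam fun n =>
        exists_small_cover hb.le subset_rfl (fun w _ _ => hcon w) hη
    have h2 : Filter.Tendsto (fun η : ℝ => ENNReal.ofReal ((d * (2 * R)) ^ b * η))
        (nhdsWithin 0 (Set.Ioi 0)) (nhds 0) := by
      have : Filter.Tendsto (fun η : ℝ => (d * (2 * R)) ^ b * η) (nhds 0) (nhds 0) := by
        simpa using (continuous_const_mul ((d * (2 * R)) ^ b)).tendsto 0
      simpa using (ENNReal.tendsto_ofReal this).mono_left nhdsWithin_le_nhds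
    exact ge_of_tendsto h2 (Filter.eventually_of_mem self_mem_nhdsWithin h1)
  obtain ⟨E, hE, hE'⟩ := exists_monotone_sets hb₀ hb.le (hK.isClosed.preimage hcont) hI₀
  refine ⟨fun α => decode R '' E α, fun α β hαβ => Set.image_mono (hE hαβ), fun α hα hαb => ?_⟩
  obtain ⟨h1, h2, ⟨c₀, hc₀, h3⟩, h4⟩ := hE' α hα hαb
  refine ⟨h1.image hcont, Set.image_subset_iff.2 h2, ?_, ?_⟩
  · exact hausdorffMeasure_image_pos (C := 3 ^ d) (show 0 < 2 * R by positivity) hα hc₀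
      (fun k t ht => exists_cover_preimage_decode hR k ht) h1 h3
  · exact (hausdorffMeasure_image_le hD hα hdiam h4).trans_lt ENNReal.ofReal_lt_top

end Digits

end CodeTree

/-! ### Gluing the families as the exponent bound tends to the dimension. -/

theorem theorem3p1 (d : ℕ) (K : Set (EuclideanSpace ℝ (Fin d))) (hK : IsCompact K) :
    ∃ E : ℝ → Set (EuclideanSpace ℝ (Fin d)),
      (∀ α : ℝ, 0 < α → ENNReal.ofReal α < dimH K →
        IsCompact (E α) ∧ E α ⊆ K ∧ 0 < μH[α] (E α) ∧ μH[α] (E α) < ⊤) ∧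
      (∀ α β : ℝ, 0 < α → α ≤ β → ENNReal.ofReal β < dimH K → E α ⊆ E β) := by
  rcases eq_or_ne (dimH K) 0 with h0 | h0
  · exact ⟨fun _ => ∅, by simp [h0], by simp⟩
  have hfin : dimH K ≠ ⊤ := by
    refine ne_top_of_le_ne_top ?_ (dimH_mono (Set.subset_univ K))
    rw [Real.dimH_univ_eq_finrank]
    exact ENNReal.natCast_ne_top _
  obtain ⟨u, -, hu, hulim⟩ := exists_seq_strictMono_tendsto' (ENNReal.toReal_pos h0 hfin)
  have hfam : ∀ n, ∃ E : ℝ → Set (EuclideanSpace ℝ (Fin d)), Monotone E ∧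
      ∀ α, 0 < α → α ≤ u n →
        IsCompact (E α) ∧ E α ⊆ K ∧ 0 < μH[α] (E α) ∧ μH[α] (E α) < ⊤ := by
    intro n
    obtain ⟨b, hub, hbs⟩ := exists_between (hu n).2
    have hb : 0 < b := (hu n).1.trans hub
    refine CodeTree.exists_monotone_of_hausdorffMeasure_ne_zero hK hub hb ?_
    have := hausdorffMeasure_of_lt_dimH ((ENNReal.ofReal_lt_iff_lt_toReal hb.le hfin).2 hbs)
    rw [Real.coe_toNNReal b hb.le] at this
    exact this.trans_ne ENNReal.top_ne_zero
  choose E hmono hE using hfam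
  let m : ℝ → ℕ := fun α => sInf {n | α ≤ u n}
  have hm : ∀ α, 0 < α → ENNReal.ofReal α < dimH K → α ≤ u (m α) := fun α hα hαs =>
    Nat.sInf_mem (s := {n | α ≤ u n}) (hulim.eventually_const_le
      ((ENNReal.ofReal_lt_iff_lt_toReal hα.le hfin).1 hαs)).exists
  -- The `n`-th family is controlled only up to `u n`, so its exponent is clipped there; this keeps
  -- the `α`-measure finite. The term `n = m α` is not clipped and gives positivity. Both the index
  -- range and the terms grow with `α`.
  refine ⟨fun α => ⋃ n ∈ Finset.range (m α + 1), E n (min α (u n)), fun α hα hαs => ?_,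
    fun α β hα hαβ hβ => ?_⟩
  · have hn : ∀ n, _ := fun n => hE n (min α (u n)) (lt_min hα (hu n).1) (min_le_right _ _)
    refine ⟨Finset.isCompact_biUnion _ fun n _ => (hn n).1, Set.iUnion₂_subset fun n _ =>
      (hn n).2.1, ?_, ?_⟩
    · refine (hE (m α) α hα (hm α hα hαs)).2.2.1.trans_le (MeasureTheory.measure_mono ?_)
      refine Set.subset_iUnion₂_of_subset (m α) (Finset.self_mem_range_succ _) ?_
      rw [min_eq_left (hm α hα hαs)]
    · refine MeasureTheory.measure_biUnion_lt_top (Finset.finite_toSet _) fun n _ => ?_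
      exact (MeasureTheory.Measure.hausdorffMeasure_mono (min_le_left _ _) _).trans_lt (hn n).2.2.2
  · have hmm : m α ≤ m β := Nat.sInf_le (hαβ.trans (hm β (hα.trans_le hαβ) hβ))
    refine Set.iUnion₂_subset fun n hn => Set.subset_iUnion₂_of_subset n ?_
      (hmono n (min_le_min_right _ hαβ))
    rw [Finset.mem_range] at hn ⊢
    omega
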